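/- **Model.** There are $n\ge 2$ stations with names $0,\dots,n-1$ attached to a multiple access channel; they work in synchronous rounds, start together and know $n$. A packet is a pair (destination station, content). In a round each station is switched on or off; the rounds that a station spends switched off are determined when it switches off. A switched-on station may transmit one message, consisting of at most one packet and of control bits. If exactly one station transmits in a round, then all switched-on stations hear its message; otherwise nothing is heard. Stations can have packets injected into them whether on or off, and each station keeps its packets in a queue, in the order of injection. A packet that is heard while its destination is switched on is delivered and disappears. A packet injected in a round can be used from the next round on. An adversary of injection rate $\rho>0$ and burstiness coefficient $\beta\ge 1$ may inject, in total, at most $\rho t+\beta$ packets in each interval of $t$ consecutive rounds, into any stations and with any destinations. All queues are empty at the beginning. The number of packets queued in a round counts all packets that are in queues at the start of the round or are injected in the course of it. An algorithm is *stable* at rate $\rho$ if for each $\beta\ge1$ the number of queued packets is bounded over all rounds of all executions against adversaries of type $(\rho,\beta)$; it *routes directly* if every packet heard on the channel comes from the queue of the transmitter and is delivered in the same round, so that there are no relays; it has *energy cap* $k$ if at most $k$ stations are switched on in any round of any execution. **Algorithm Orchestra.** The rounds are partitioned into seasons of $n-1$ consecutive rounds. Each season has a conductor; the other stations are musicians.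 Each station keeps a private copy of the baton list, initially all stations ordered by name. The first station on the list conducts the first season, and the baton is then passed on along the list in cyclic order, with the exception below. The conductor is switched on and transmits in each round of its season. In the $r$-th round of the season the $r$-th musician in the order of names is switched on to *learn*; moreover, a musician is switched on to *receive* in the rounds it was taught in the previous season of the same conductor. Packets that are in a station's queue at the start of a season are called old. At the start of its season the conductor selects, for its next season as a conductor, the first $n-1$ packets in the order of injection (or all, if fewer) among its old packets not yet scheduled for the current season. The selected packets are sent one per round from the start of that next season, in the order of injection or, more generally, in the order given by an arbitrary fixed rule that permutes the selected packets. In each round of the current season the conductor sends the next packet scheduled for this season, if there is one left (otherwise the message has no packet), and teaches the learning musician the rounds of the conductor's next season in which packets destined for this musician will be sent, together with a toggle bit telling whether the conductor is big. The conductor is *big* if it has at least $n^2-1$ packets in its queue at the start of the season. A big conductor is moved to the front of the baton list (in its own copy at the start of the season, in the copy of a musician when this musician learns), and keeps the baton for the next season. **Theorem.** Let $n\ge2$. For every rule for arranging the packets selected for a season (in particular for the order of injection), algorithm Orchestra for $n$ stations has energy cap $3$ and routes directly, and the following holds: for each $\beta\ge1$, in every round of every execution against an adversary of injection rate $1$ and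 burstiness coefficient $\beta$ there are at most $2n^3+\beta$ packets queued. In particular, Orchestra is stable at rate $1$, and $1$ is the largest injection rate at which it is stable. Moreover, if the packets selected for a season are arranged by their destinations (and in the order of injection for each destination), then $2\lceil\log_2 n\rceil+1$ control bits per message suffice to encode the control information. -/

import Mathlib

universe u

/-- A packet `(d, c)`: the destination station `d` and the content `c`. -/
abbrev Packet (n : ℕ) (C : Type u) : Type u := Fin n × C

/-- A message consists of at most one packet and of control information. -/
structure Message (n : ℕ) (C : Type u) (Ctrl : Type) : Type u where
  packet : Option (Packet n C)
  control : Ctrl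

/-- A deterministic distributed routing algorithm for `n` stations attached to a multiple access
channel. Every function takes the name of a station and the number of the round (the stations start
together and share the clock); besides, it sees the private state of that station only, and its
queue or the feedback from the channel only in rounds in which the station is switched on.

While a station is switched off, its state evolves by `idle`, which has no other input than the
clock. So the rounds that a station spends switched off are determined at the moment when it
switches off, which is the effect of setting a timer. -/
structure RoutingAlgorithm (n : ℕ) (C : Type u) where
  /-- private states of a station -/
  State : Type u
  /-- control information of a message -/
  Ctrl : Type
  /-- initial state -/
  init : Fin n → State
  /-- is the station switched on in this round? -/
  awake : Fin n → ℕ → State → Bool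
  /-- computation of a switched-on station at the start of a round, from its state and its queue:
  the new state and the message it transmits in this round, if any -/
  act : Fin n → ℕ → State → List (Packet n C) → State × Option (Message n C Ctrl)
  /-- state change of a switched-on station at the end of a round, after the feedback from the
  channel: `some m` if message `m` is heard, `none` if no message is heard -/
  hear : Fin n → ℕ → State → Option (Message n C Ctrl) → State
  /-- state change of a switched-off station during a round -/
  idle : Fin n → ℕ → State → State
  /-- does the transmitter remove its packet that was heard without being delivered? -/
  release : Fin n → ℕ → State → Message n C Ctrl → Bool
  /-- does a switched-on station that hears the message adopt its undelivered packet? -/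
  adopt : Fin n → ℕ → State → Message n C Ctrl → Bool

/-- An injection pattern: the packets injected in each round into each station, in the order of
injection. -/
abbrev Injection (n : ℕ) (C : Type u) : Type u := ℕ → Fin n → List (Packet n C)

/-- The number of packets injected into all the stations in round `t`. -/
def Injection.count {n : ℕ} {C : Type u} (inj : Injection n C) (t : ℕ) : ℕ :=
  ∑ i, (inj t i).length

/-- The leaky-bucket adversary of type `(ρ, β)`: at most `ρ * t + β` packets in each interval of
`t` consecutive rounds. -/
def Injection.IsOfType {n : ℕ} {C : Type u} (inj : Injection n C) (ρ β : ℝ) : Prop :=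
  ∀ s t : ℕ, ((∑ r ∈ Finset.range t, inj.count (s + r) : ℕ) : ℝ) ≤ ρ * t + β

namespace RoutingAlgorithm

variable {n : ℕ} {C : Type u}

/-- The states and the queues of all the stations at the start of a round. A queue lists its
packets in the order of arrival. -/
structure Config (A : RoutingAlgorithm n C) : Type u where
  state : Fin n → A.State
  queue : Fin n → List (Packet n C)

variable (A : RoutingAlgorithm n C)

/-- Station `i` is switched on in round `t`. -/
def isOn (t : ℕ) (cfg : A.Config) (i : Fin n) : Bool := A.awake i t (cfg.state i)

/-- The state of a switched-on station `i` after its computation at the start of round `t`. -/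
def acted (t : ℕ) (cfg : A.Config) (i : Fin n) : A.State :=
  (A.act i t (cfg.state i) (cfg.queue i)).1

/-- The message transmitted by station `i` in round `t`, if any. -/
def sent (t : ℕ) (cfg : A.Config) (i : Fin n) : Option (Message n C A.Ctrl) :=
  if A.isOn t cfg i then (A.act i t (cfg.state i) (cfg.queue i)).2 else none

/-- The message heard in round `t` by all the switched-on stations: there is one precisely if
exactly one station transmits. -/
def heard (t : ℕ) (cfg : A.Config) : Option (Message n C A.Ctrl) :=
  match (List.finRange n).filterMap (A.sent t cfg) with
  | [m] => some m
  | _ => none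

/-- The queue of station `i` at the end of round `t`, injections excepted. A packet that is heard
while its destination is switched on is delivered: it disappears from the system. -/
def settled [DecidableEq C] (t : ℕ) (cfg : A.Config) (i : Fin n) : List (Packet n C) :=
  match A.heard t cfg with
  | none => cfg.queue i
  | some m =>
    match m.packet with
    | none => cfg.queue i
    | some p =>
      if (A.sent t cfg i).isSome then
        if A.isOn t cfg p.1 || A.release i t (A.acted t cfg i) m then (cfg.queue i).erase p
        else cfg.queue i
      else
        if A.isOn t cfg i && !A.isOn t cfg p.1 && A.adopt i t (A.acted t cfg i) m then
          cfg.queue i ++ [p]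
        else cfg.queue i

/-- One round of an execution. The packets injected in a round can be used from the next round
on. -/
def step [DecidableEq C] (inj : Injection n C) (t : ℕ) (cfg : A.Config) : A.Config where
  state i :=
    if A.isOn t cfg i then A.hear i t (A.acted t cfg i) (A.heard t cfg)
    else A.idle i t (cfg.state i)
  queue i := A.settled t cfg i ++ inj t i

/-- The configuration at the start of round `t` (rounds are numbered from `0`) of the execution
against the given injections. All the queues are empty at the beginning. -/
def config [DecidableEq C] (inj : Injection n C) : ℕ → A.Config
  | 0 => ⟨A.init, fun _ => []⟩
  | t + 1 => A.step inj t (config inj t)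

/-- The number of packets queued in round `t`: all those that are in a queue at the start of the
round or get injected in the course of it. -/
def queueSize [DecidableEq C] (inj : Injection n C) (t : ℕ) : ℕ :=
  ∑ i, ((A.config inj t).queue i).length + inj.count t

/-- At most `k` stations are switched on in any round of any execution. -/
def HasEnergyCap [DecidableEq C] (k : ℕ) : Prop :=
  ∀ (inj : Injection n C) (t : ℕ),
    (Finset.univ.filter fun i => A.isOn t (A.config inj t) i = true).card ≤ k

/-- Direct routing: a packet that is heard on the channel comes from the queue of the transmitter,
and it is delivered in the same round, its destination being switched on. So no station ever acts
as a relay, and each packet makes a single hop from the station into which it was injected straight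
to its destination. -/
def RoutesDirectly [DecidableEq C] : Prop :=
  ∀ (inj : Injection n C) (t : ℕ) (i : Fin n) (m : Message n C A.Ctrl) (p : Packet n C),
    A.sent t (A.config inj t) i = some m → A.heard t (A.config inj t) = some m →
    m.packet = some p →
      p ∈ (A.config inj t).queue i ∧ A.isOn t (A.config inj t) p.1 = true

/-- Stability at injection rate `ρ`: against the adversaries of type `(ρ, β)`, for each `β ≥ 1`,
the number of queued packets is bounded. -/
def IsStableAt [DecidableEq C] (ρ : ℝ) : Prop :=
  ∀ β : ℝ, 1 ≤ β → ∃ B : ℕ, ∀ inj : Injection n C, inj.IsOfType ρ β →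
    ∀ t : ℕ, A.queueSize inj t ≤ B

/-- The control information that occurs in the messages of all possible executions. -/
def usedControls [DecidableEq C] : Set A.Ctrl :=
  {c | ∃ (inj : Injection n C) (t : ℕ) (i : Fin n) (m : Message n C A.Ctrl),
    A.sent t (A.config inj t) i = some m ∧ m.control = c}

/-- The control information of a message can be written with at most `b` bits. -/
def UsesControlBits [DecidableEq C] (b : ℕ) : Prop :=
  ∃ code : A.Ctrl → List Bool,
    Set.InjOn code A.usedControls ∧ ∀ c ∈ A.usedControls, (code c).length ≤ b

end RoutingAlgorithm

namespace Orchestra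

/-- Control information in a message of a conductor: the toggle bit telling that the conductor is
big, and the rounds of the next season of the same conductor (numbered `0, …, n - 2` within the
season) in which the taught musician is to be switched on to receive. -/
structure Control where
  big : Bool
  rounds : Finset ℕ

/-- Private state of a station. -/
structure State (n : ℕ) (C : Type u) : Type u where
  /-- private copy of the baton list -/
  baton : List (Fin n)
  /-- position of the baton (the front of the list is position `0`) -/
  pos : ℕ
  /-- the conductor of the current season is known to be big, and so it keeps the baton -/
  keep : Bool
  /-- for each conductor, the rounds to be switched on to receive during its current season (for
  the conductor of the current season) or its next season (for another station) -/
  receive : Fin n → Finset ℕ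
  /-- the rounds taught by the current conductor for its next season -/
  taught : Finset ℕ
  /-- the packets to be sent, in this order, in the own current season as a conductor or, outside
  such a season, in the next one -/
  sched : List (Packet n C)
  /-- during an own season as a conductor: the packets scheduled for the own next season -/
  plan : List (Packet n C)

variable {n : ℕ} {C : Type u}

/-- The conductor of the current season, as the station knows it. -/
def State.conductor (s : State n C) : Option (Fin n) := s.baton[s.pos]?

/-- The initial state: the baton list is ordered by names and the first station has the baton. -/
def initState (n : ℕ) (C : Type u) : State n C where
  baton := List.finRange n
  pos := 0
  keep := false
  receive := fun _ => ∅
  taught := ∅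
  sched := []
  plan := []

/-- The station `c` moves to the front of the baton list, keeping the baton. -/
def State.promote (s : State n C) (c : Fin n) : State n C :=
  { s with baton := c :: s.baton.erase c, pos := 0, keep := true }

/-- The number of round `t` within its season; a season has `n - 1` rounds. -/
def phase (n t : ℕ) : ℕ := t % (n - 1)

/-- The musician that learns in round `r` of a season with conductor `c`: the musicians learn one
by one, in the order of their names. -/
def learner (c : Fin n) (r : ℕ) : Option (Fin n) :=
  ((List.finRange n).filter (fun j => j ≠ c))[r]?

/-- A conductor is switched on throughout the season, a musician when it learns or receives. -/
def awake (i : Fin n) (t : ℕ) (s : State n C) : Bool :=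
  match s.conductor with
  | none => false
  | some c =>
    decide (i = c) || decide (learner c (phase n t) = some i) ||
      decide (phase n t ∈ s.receive c)

/-- What a conductor does at the start of its season, with queue `q` (all packets in it are old).
It schedules for its next season the `n - 1` first injected packets (or all, if they are fewer)
among those that are not scheduled for the current season; `arr` is the order in which the packets
selected for a season will be sent. If it has at least `n ^ 2 - 1` packets, then it is big and moves
to the front of the baton list. -/
def begin_season [DecidableEq C] (arr : List (Packet n C) → List (Packet n C)) (i : Fin n)
    (s : State n C) (q : List (Packet n C)) : State n C :=
  let s' : State n C := { s with plan := arr ((q.diff s.sched).take (n - 1)) }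
  if n ^ 2 - 1 ≤ q.length then s'.promote i else s'

/-- The rounds of a season with schedule `l` in which packets destined for `j` are sent. -/
def roundsFor (l : List (Packet n C)) (j : Fin n) : Finset ℕ :=
  (Finset.range l.length).filter fun r => l[r]?.map Prod.fst = some j

/-- The message transmitted by a conductor `i` in round `r` of its season. It contains the `r`th
scheduled packet, and no packet (a light round) if fewer packets are scheduled. -/
def message (i : Fin n) (r : ℕ) (s : State n C) : Message n C Control where
  packet := s.sched[r]?
  control :=
    { big := s.keep
      rounds := match learner i r with
        | none => ∅
        | some j => roundsFor s.plan j }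

/-- A conductor transmits in every round of its season; the other stations never transmit. -/
def act [DecidableEq C] (arr : List (Packet n C) → List (Packet n C)) (i : Fin n) (t : ℕ)
    (s : State n C) (q : List (Packet n C)) : State n C × Option (Message n C Control) :=
  if s.conductor = some i then
    let s' := if phase n t = 0 then begin_season arr i s q else s
    (s', some (message i (phase n t) s'))
  else (s, none)

/-- A musician learns: it stores its rounds for the next season of the conductor, and moves a big
conductor to the front of its copy of the baton list. -/
def learn (i : Fin n) (t : ℕ) (s : State n C) (m : Message n C Control) : State n C :=
  match s.conductor with
  | none => s
  | some c =>
    if learner c (phase n t) = some i then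
      let s' : State n C := { s with taught := m.control.rounds }
      if m.control.big then s'.promote c else s'
    else s

/-- The end of a season: what was scheduled and taught for the next season of the conductor takes
effect, and the baton is passed on cyclically, unless the conductor keeps it. -/
def end_season (i : Fin n) (s : State n C) : State n C :=
  match s.conductor with
  | none => s
  | some c =>
    { s with
      pos := if s.keep then s.pos else (s.pos + 1) % n
      keep := false
      receive := Function.update s.receive c s.taught
      taught := ∅
      sched := if i = c then s.plan else s.sched
      plan := [] }

/-- State change due to the clock at the end of round `t`. -/
def tick (i : Fin n) (t : ℕ) (s : State n C) : State n C :=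
  if phase n (t + 1) = 0 then end_season i s else s

/-- State change of a switched-on station at the end of round `t`. -/
def hear (i : Fin n) (t : ℕ) (s : State n C) (msg : Option (Message n C Control)) : State n C :=
  tick i t (match msg with
    | none => s
    | some m => learn i t s m)

/-- Grouping the packets of a season by destination, in the order of injection for each
destination. -/
def byDestination (l : List (Packet n C)) : List (Packet n C) :=
  l.mergeSort (fun p q => decide (p.1 ≤ q.1))

end Orchestra

/-- Algorithm Orchestra. The parameter `arr` arranges the packets selected for one season, which
are given in the order of their injections; `arr = id` sends them in this very order. -/
def orchestra (n : ℕ) (C : Type u) [DecidableEq C]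
    (arr : List (Packet n C) → List (Packet n C)) : RoutingAlgorithm n C where
  State := Orchestra.State n C
  Ctrl := Orchestra.Control
  init := fun _ => Orchestra.initState n C
  awake := Orchestra.awake
  act := Orchestra.act arr
  hear := Orchestra.hear
  idle := Orchestra.tick
  release := fun _ _ _ _ => false
  adopt := fun _ _ _ _ => false

/-!
Within a season, all stations agree on who conducts, and each of them knows exactly what it has to
know: a musician that has not yet learned is in the state it had at the start of the season, any
other station, as soon as the conductor has decided, in the state that results from these decisions
(`Season.stateAt`).
So the conductor is the only transmitter, its message is heard, and the destination of the packet
scheduled for the round is switched on, since it was taught so in the previous season of the same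
conductor. This is `IsSeasonStart.config_season`; the energy cap and direct routing can be read off.
Only the conductor loses packets in a season, namely those of its schedule, and a season is light
if this schedule has fewer than `n - 1` packets.

For the bound at rate `1`, the number of queued packets grows, up to the burstiness, only by the
number of light rounds, so it suffices to bound the number of light seasons since the last time that
a season started with at most `n ^ 3 - 2 * n` packets. As long as there are more packets, some
station has at least `n ^ 2 - 1` of them, hence the baton, starting from the head of the list, meets
a big station before it reaches the end. A station that has been found big stays at the head of the
list, among those found before, and has enough packets to fill its seasons: the baton passes it at
most once between two discoveries, and each time it does so, the next big station jumps over it, so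
that it moves down one position. With `n ^ 2 - 1 = (n - 1) * (n + 1)` packets at the time of its last big season its
reserve lasts until it is at the end of the list. So only stations not yet found have light
seasons, at most `n` before each new discovery; this is the invariant `Search`, kept by
`Search.pass` and `Search.find`. There are at most `n + n * n` light seasons, and
`(n ^ 3 - 2 * n) + (n - 1) * (n + n * n + 1) ≤ 2 * n ^ 3`.

At most one packet is delivered per round, so there is no stability at a rate above `1`. If the
selected packets are sorted by destination, a musician is taught an interval of rounds, which is
determined by its first round and its length, two numbers below `n`.
-/

namespace Orchestra

variable {n : ℕ} {C : Type u}

/-! ### Musicians -/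

theorem learner_ne {c i : Fin n} {r : ℕ} (h : learner c r = some i) : i ≠ c := by
  have := List.mem_of_getElem? h
  simpa using this

theorem length_musicians (c : Fin n) :
    ((List.finRange n).filter (fun j => j ≠ c)).length = n - 1 := by
  have h : (List.finRange n).filter (fun j => j ≠ c) = (List.finRange n).erase c := by
    rw [(List.nodup_finRange n).erase_eq_filter]
    congr 1
    ext x
    by_cases hx : x = c <;> simp [hx]
  rw [h, List.length_erase_of_mem (List.mem_finRange c), List.length_finRange]

theorem learner_injective {c i : Fin n} {r s : ℕ} (hr : learner c r = some i)
    (hs : learner c s = some i) : r = s := by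
  have hlt := (List.getElem?_eq_some_iff.1 hr).1
  exact (List.getElem?_inj hlt ((List.nodup_finRange n).filter _)).1 (hr.trans hs.symm)

theorem exists_learner {c i : Fin n} (h : i ≠ c) : ∃ r < n - 1, learner c r = some i := by
  have hi : i ∈ (List.finRange n).filter (fun j => j ≠ c) := by simp [h]
  obtain ⟨r, hr⟩ := List.mem_iff_getElem?.1 hi
  refine ⟨r, ?_, hr⟩
  rw [← length_musicians c]
  exact (List.getElem?_eq_some_iff.1 hr).1

theorem mem_roundsFor {l : List (Packet n C)} {j : Fin n} {r : ℕ} :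
    r ∈ roundsFor l j ↔ ∃ p, l[r]? = some p ∧ p.1 = j := by
  simp only [roundsFor, Finset.mem_filter, Finset.mem_range]
  constructor
  · rintro ⟨-, h⟩
    rcases hl : l[r]? with _ | p
    · simp [hl] at h
    · exact ⟨p, rfl, by simpa [hl] using h⟩
  · rintro ⟨p, hp, rfl⟩
    exact ⟨(List.getElem?_eq_some_iff.1 hp).1, by simp [hp]⟩

theorem phase_season (m : ℕ) {r : ℕ} (hr : r < n - 1) : phase n (m * (n - 1) + r) = r := by
  rw [phase, Nat.mul_add_mod_self_right, Nat.mod_eq_of_lt hr]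

/-! ### The states of the stations in the course of a season -/

/-- The state of station `i` at the start of a season: the stations agree on the baton list and on
the position of the baton, and each of them knows in which rounds of the next season of another
station it has to receive, namely those in which a packet destined for it is scheduled. -/
def startState (baton : List (Fin n)) (pos : ℕ) (sched : Fin n → List (Packet n C)) (i : Fin n) :
    State n C where
  baton := baton
  pos := pos
  keep := false
  receive := fun c => if c = i then ∅ else roundsFor (sched c) i
  taught := ∅
  sched := sched i
  plan := []

/-- The data of one season: the common baton list and the position of the baton at its start, the
schedules of all stations, the conductor, its selection `plan` for its next season, and whether
it is big. -/
structure Season (n : ℕ) (C : Type u) where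
  baton : List (Fin n)
  pos : ℕ
  sched : Fin n → List (Packet n C)
  conductor : Fin n
  plan : List (Packet n C)
  big : Bool

namespace Season

variable (S : Season n C)

/-- The state of station `i` at the start of the season. -/
def initial (i : Fin n) : State n C := startState S.baton S.pos S.sched i

/-- The state of station `i` once it knows all it has to know about the season: the conductor after
its decisions at the start of the season, a musician after it has learned. -/
def informed (i : Fin n) : State n C :=
  let s : State n C :=
    { S.initial i with
      taught := if i = S.conductor then ∅ else roundsFor S.plan i
      plan := if i = S.conductor then S.plan else [] }
  if S.big then s.promote S.conductor else s

/-- Station `i` has learned before round `r` of the season. -/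
def HasLearned (r : ℕ) (i : Fin n) : Prop := ∃ s < r, learner S.conductor s = some i

open Classical in
/-- The state of station `i` at the start of round `r` of the season. -/
noncomputable def stateAt (r : ℕ) (i : Fin n) : State n C :=
  if (i = S.conductor ∧ 0 < r) ∨ S.HasLearned r i then S.informed i else S.initial i

open Classical in
/-- The state of a switched-on station `i` after its computation at the start of round `r`. -/
noncomputable def actedAt (r : ℕ) (i : Fin n) : State n C :=
  if i = S.conductor ∨ S.HasLearned r i then S.informed i else S.initial i

/-- The baton list at the end of the season. -/
def nextBaton : List (Fin n) :=
  if S.big then S.conductor :: S.baton.erase S.conductor else S.baton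

/-- The position of the baton after the season. -/
def nextPos : ℕ := if S.big then 0 else (S.pos + 1) % n

/-- The schedules after the season. -/
def nextSched : Fin n → List (Packet n C) := Function.update S.sched S.conductor S.plan

theorem hasLearned_succ (r : ℕ) (i : Fin n) :
    S.HasLearned (r + 1) i ↔ S.HasLearned r i ∨ learner S.conductor r = some i := by
  simp only [HasLearned, Nat.lt_succ_iff_lt_or_eq]
  constructor
  · rintro ⟨s, hs | rfl, h⟩
    exacts [Or.inl ⟨s, hs, h⟩, Or.inr h]
  · rintro (⟨s, hs, h⟩ | h)
    exacts [⟨s, Or.inl hs, h⟩, ⟨r, Or.inr rfl, h⟩]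

theorem stateAt_zero (i : Fin n) : S.stateAt 0 i = S.initial i := by
  simp [stateAt, HasLearned]

theorem stateAt_eq_actedAt {r : ℕ} {i : Fin n} (h : i ≠ S.conductor ∨ 0 < r) :
    S.stateAt r i = S.actedAt r i := by
  unfold stateAt actedAt
  congr 1
  simp only [eq_iff_iff]
  tauto

theorem actedAt_conductor (r : ℕ) : S.actedAt r S.conductor = S.informed S.conductor := by
  simp [actedAt]

theorem stateAt_conductor {r : ℕ} (hr : 0 < r) :
    S.stateAt r S.conductor = S.informed S.conductor := by
  simp [stateAt, hr]

theorem informed_plan : (S.informed S.conductor).plan = S.plan := by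
  unfold informed; cases S.big <;> simp [State.promote]

theorem informed_sched (i : Fin n) : (S.informed i).sched = S.sched i := by
  unfold informed; cases S.big <;> simp [State.promote, initial, startState]

theorem informed_keep (i : Fin n) : (S.informed i).keep = S.big := by
  unfold informed; cases S.big <;> simp [State.promote, initial, startState]

theorem informed_receive (i : Fin n) : (S.informed i).receive = (S.initial i).receive := by
  unfold informed; cases S.big <;> simp [State.promote]

variable {S}

theorem conductor_initial (hc : S.baton[S.pos]? = some S.conductor) (i : Fin n) :
    (S.initial i).conductor = some S.conductor := hc

theorem conductor_informed (hc : S.baton[S.pos]? = some S.conductor) (i : Fin n) :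
    (S.informed i).conductor = some S.conductor := by
  unfold informed
  cases S.big
  · simpa [State.conductor, initial, startState] using hc
  · simp [State.conductor, State.promote]

theorem conductor_stateAt (hc : S.baton[S.pos]? = some S.conductor) (r : ℕ) (i : Fin n) :
    (S.stateAt r i).conductor = some S.conductor := by
  unfold stateAt
  split_ifs
  exacts [conductor_informed hc i, conductor_initial hc i]

theorem conductor_actedAt (hc : S.baton[S.pos]? = some S.conductor) (r : ℕ) (i : Fin n) :
    (S.actedAt r i).conductor = some S.conductor := by
  unfold actedAt
  split_ifs
  exacts [conductor_informed hc i, conductor_initial hc i]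

theorem receive_stateAt (r : ℕ) (i c : Fin n) :
    (S.stateAt r i).receive c = if c = i then ∅ else roundsFor (S.sched c) i := by
  unfold stateAt
  split_ifs with h <;> simp_all [informed_receive, initial, startState]

/-- The stations switched on are the conductor, the learning musician and the destination of the
packet of the round. -/
theorem awake_stateAt (hc : S.baton[S.pos]? = some S.conductor) {t r : ℕ} (ht : phase n t = r)
    (i : Fin n) : awake i t (S.stateAt r i) = true ↔ i = S.conductor ∨ learner S.conductor r = some i ∨
      ∃ p, (S.sched S.conductor)[r]? = some p ∧ p.1 = i ∧ S.conductor ≠ i := by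
  rw [awake, conductor_stateAt hc]
  simp only [ht, receive_stateAt, Bool.or_eq_true, decide_eq_true_eq, or_assoc]
  by_cases h : S.conductor = i
  · simp [h]
  · simp [h, mem_roundsFor]

/-- Learning makes a musician informed. -/
theorem learn_actedAt (hc : S.baton[S.pos]? = some S.conductor) {t r : ℕ} (ht : phase n t = r)
    (i : Fin n) :
    learn i t (S.actedAt r i) (message S.conductor r (S.informed S.conductor)) =
      S.stateAt (r + 1) i := by
  rw [learn, conductor_actedAt hc]
  simp only [ht]
  by_cases hl : learner S.conductor r = some i
  · have hi := learner_ne hl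
    have hk : ¬ S.HasLearned r i := by
      rintro ⟨s, hs, h⟩
      exact hs.ne (learner_injective h hl)
    have hplan := S.informed_plan
    have h1 : S.actedAt r i = S.initial i := by simp [actedAt, hi, hk]
    have h2 : S.stateAt (r + 1) i = S.informed i := by simp [stateAt, hasLearned_succ, hl]
    rw [if_pos hl, h1, h2]
    simp only [message, informed_keep, hl, hplan]
    simp [informed, hi]
    rfl
  · rw [if_neg hl, actedAt, stateAt]
    classical refine if_congr ?_ rfl rfl
    rw [hasLearned_succ]
    simp [hl]

/-- A station that does not learn keeps its state until the end of the round. -/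
theorem stateAt_succ_of_not_learner {r : ℕ} {i : Fin n} (h : i = S.conductor → 0 < r)
    (hl : learner S.conductor r ≠ some i) : S.stateAt (r + 1) i = S.stateAt r i := by
  classical refine if_congr ?_ rfl rfl
  rw [hasLearned_succ]
  constructor
  · rintro (⟨h1, -⟩ | h1 | h1)
    exacts [Or.inl ⟨h1, h h1⟩, Or.inr h1, (hl h1).elim]
  · rintro (⟨h1, -⟩ | h1)
    exacts [Or.inl ⟨h1, by omega⟩, Or.inr (Or.inl h1)]

/-- All the stations are informed at the end of the season. -/
theorem stateAt_last (hn : 2 ≤ n) (i : Fin n) : S.stateAt (n - 1) i = S.informed i := by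
  rw [stateAt, if_pos]
  by_cases h : i = S.conductor
  · exact Or.inl ⟨h, by omega⟩
  · obtain ⟨r, hr, hl⟩ := exists_learner h
    exact Or.inr ⟨r, hr, hl⟩

theorem end_season_informed (hc : S.baton[S.pos]? = some S.conductor) (i : Fin n) :
    end_season i (S.informed i) = startState S.nextBaton S.nextPos S.nextSched i := by
  rw [end_season, conductor_informed hc]
  have hr : Function.update (S.informed i).receive S.conductor (S.informed i).taught =
      fun c => if c = i then ∅ else roundsFor (S.nextSched c) i := by
    have ht : (S.informed i).taught = if i = S.conductor then ∅ else roundsFor S.plan i := by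
      unfold informed; cases S.big <;> simp [State.promote]
    funext c
    rw [ht, informed_receive]
    by_cases h : c = S.conductor
    · subst h
      simp [nextSched, eq_comm]
    · simp [h, nextSched, initial, startState]
  have hs : (if i = S.conductor then (S.informed i).plan else (S.informed i).sched) =
      S.nextSched i := by
    split_ifs with h
    · subst h
      simp [informed_plan, nextSched]
    · simp [informed_sched, nextSched, h]
  simp only [hr, hs]
  unfold startState nextBaton nextPos informed
  cases S.big <;> simp [State.promote, initial, startState]

end Season
end Orchestra

theorem filterMap_finRange_eq_singleton {n : ℕ} {α : Type*} (c : Fin n) (a : α) :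
    (List.finRange n).filterMap (fun i => if i = c then some a else none) = [a] := by
  have h : ∀ l : List (Fin n), l.Nodup → c ∈ l →
      l.filterMap (fun i => if i = c then some a else none) = [a] := by
    intro l
    induction l with
    | nil => simp
    | cons x l ih =>
      intro hnd hmem
      rw [List.nodup_cons] at hnd
      by_cases hx : x = c
      · subst hx
        simp only [List.filterMap_cons, if_true, List.cons.injEq, true_and]
        rw [List.filterMap_eq_nil_iff]
        intro y hy
        rw [if_neg]
        rintro rfl
        exact hnd.1 hy
      · have : c ∈ l := by simpa [Ne.symm hx] using hmem
        simp [hx, ih hnd.2 this]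
  exact h _ (List.nodup_finRange n) (List.mem_finRange c)

/-! ### Rounds with a single transmitter -/

namespace RoutingAlgorithm

variable {n : ℕ} {C : Type u} {A : RoutingAlgorithm n C} {t : ℕ} {cfg : A.Config} {c : Fin n}
  {m : Message n C A.Ctrl}

theorem heard_eq_of_sent (h : ∀ i, A.sent t cfg i = if i = c then some m else none) :
    A.heard t cfg = some m := by
  rw [heard, funext h, filterMap_finRange_eq_singleton]

variable [DecidableEq C]

theorem settled_of_not_sent (h : ∀ i, A.sent t cfg i = if i = c then some m else none)
    {i : Fin n} (hi : i ≠ c) (hadopt : ∀ s m, A.adopt i t s m = false) :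
    A.settled t cfg i = cfg.queue i := by
  rw [settled, heard_eq_of_sent h]
  simp only [h, if_neg hi, hadopt]
  rcases m.packet with _ | p <;> simp

theorem settled_of_sent (h : ∀ i, A.sent t cfg i = if i = c then some m else none)
    (hon : ∀ p, m.packet = some p → A.isOn t cfg p.1 = true) :
    A.settled t cfg c =
      match m.packet with
      | none => cfg.queue c
      | some p => (cfg.queue c).erase p := by
  rw [settled, heard_eq_of_sent h]
  simp only [h]
  rcases hp : m.packet with _ | p
  · rfl
  · simp [hon p hp]

end RoutingAlgorithm

namespace Orchestra

variable {n : ℕ} {C : Type u}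

/-! ### One round of the algorithm -/

variable [DecidableEq C] {arr : List (Packet n C) → List (Packet n C)}

/-- In round `r` of the season `S`, which is round `t` of the execution, the stations have the
states that they should have; in the first round, the conductor is about to make the decisions
recorded in `S`. -/
structure Season.Describes (arr : List (Packet n C) → List (Packet n C)) (S : Season n C) (t r : ℕ)
    (cfg : (orchestra n C arr).Config) : Prop where
  conductor : S.baton[S.pos]? = some S.conductor
  phase_eq : phase n t = r
  state : ∀ i, cfg.state i = S.stateAt r i
  start : r = 0 →
    begin_season arr S.conductor (S.initial S.conductor) (cfg.queue S.conductor) =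
      S.informed S.conductor

namespace Season.Describes

variable {S : Season n C} {t r : ℕ} {cfg : (orchestra n C arr).Config}
  (h : S.Describes arr t r cfg)
include h

theorem isOn_iff (i : Fin n) : (orchestra n C arr).isOn t cfg i = true ↔
    i = S.conductor ∨ learner S.conductor r = some i ∨
      ∃ p, (S.sched S.conductor)[r]? = some p ∧ p.1 = i ∧ S.conductor ≠ i := by
  have := S.awake_stateAt h.conductor h.phase_eq i
  rw [← h.state i] at this
  exact this

theorem act_eq (i : Fin n) : act arr i t (cfg.state i) (cfg.queue i) =
    (S.actedAt r i, if i = S.conductor then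
      some (message S.conductor r (S.informed S.conductor)) else none) := by
  unfold act
  rw [h.state i, S.conductor_stateAt h.conductor, h.phase_eq]
  by_cases hi : i = S.conductor
  · subst hi
    rw [if_pos rfl, if_pos rfl, S.actedAt_conductor]
    have : (if r = 0 then begin_season arr S.conductor (S.stateAt r S.conductor)
        (cfg.queue S.conductor) else S.stateAt r S.conductor) = S.informed S.conductor := by
      split_ifs with hr
      · rw [hr, S.stateAt_zero, h.start hr]
      · exact S.stateAt_conductor (Nat.pos_of_ne_zero hr)
    simp only [this]
  · rw [if_neg (by simpa [eq_comm] using hi), if_neg hi, S.stateAt_eq_actedAt (Or.inl hi)]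

theorem acted_eq (i : Fin n) : (orchestra n C arr).acted t cfg i = S.actedAt r i :=
  congrArg Prod.fst (h.act_eq i)

theorem sent_eq (i : Fin n) : (orchestra n C arr).sent t cfg i =
    if i = S.conductor then some (message S.conductor r (S.informed S.conductor)) else none := by
  have h1 : ((orchestra n C arr).act i t (cfg.state i) (cfg.queue i)).2 = _ :=
    congrArg Prod.snd (h.act_eq i)
  rw [RoutingAlgorithm.sent, h1]
  by_cases hi : i = S.conductor
  · rw [if_pos ((h.isOn_iff i).2 (Or.inl hi))]
  · rw [if_neg hi]
    exact ite_self _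

theorem heard_eq : (orchestra n C arr).heard t cfg =
    some (message S.conductor r (S.informed S.conductor)) :=
  RoutingAlgorithm.heard_eq_of_sent h.sent_eq

omit h [DecidableEq C] in
theorem packet_eq :
    (message S.conductor r (S.informed S.conductor)).packet = (S.sched S.conductor)[r]? := by
  rw [message, S.informed_sched]

/-- The destination of the packet that is heard is switched on. -/
theorem isOn_destination {p : Packet n C} (hp : (S.sched S.conductor)[r]? = some p) :
    (orchestra n C arr).isOn t cfg p.1 = true := by
  rw [h.isOn_iff]
  by_cases hc : p.1 = S.conductor
  · exact Or.inl hc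
  · exact Or.inr (Or.inr ⟨p, hp, rfl, Ne.symm hc⟩)

theorem settled_of_ne {i : Fin n} (hi : i ≠ S.conductor) :
    (orchestra n C arr).settled t cfg i = cfg.queue i :=
  RoutingAlgorithm.settled_of_not_sent h.sent_eq hi fun _ _ => rfl

theorem settled_conductor :
    (orchestra n C arr).settled t cfg S.conductor =
      match (S.sched S.conductor)[r]? with
      | none => cfg.queue S.conductor
      | some p => (cfg.queue S.conductor).erase p := by
  rw [← packet_eq]
  exact RoutingAlgorithm.settled_of_sent h.sent_eq fun p hp =>
    h.isOn_destination ((packet_eq (S := S)).symm.trans hp)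

theorem step_state (inj : Injection n C) (i : Fin n) :
    ((orchestra n C arr).step inj t cfg).state i = tick i t (S.stateAt (r + 1) i) := by
  change (if (orchestra n C arr).isOn t cfg i = true then
      hear i t ((orchestra n C arr).acted t cfg i) ((orchestra n C arr).heard t cfg)
    else tick i t (cfg.state i)) = _
  split_ifs with hon
  · rw [h.acted_eq, h.heard_eq, hear]
    simp only [S.learn_actedAt h.conductor h.phase_eq]
  · rw [h.isOn_iff] at hon
    push Not at hon
    rw [h.state, S.stateAt_succ_of_not_learner (fun hi => (hon.1 hi).elim) hon.2.1]

/-- At most the conductor, the learner and the destination of the packet are switched on. -/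
theorem card_isOn_le :
    (Finset.univ.filter fun i => (orchestra n C arr).isOn t cfg i = true).card ≤ 3 := by
  have hsub : (Finset.univ.filter fun i => (orchestra n C arr).isOn t cfg i = true) ⊆
      {S.conductor} ∪ ((learner S.conductor r).toFinset ∪
        ((S.sched S.conductor)[r]?.map Prod.fst).toFinset) := by
    intro i hi
    rw [Finset.mem_filter, h.isOn_iff] at hi
    simp only [Finset.mem_union, Finset.mem_singleton, Option.mem_toFinset, Option.mem_def,
      Option.map_eq_some_iff]
    obtain ⟨-, hi | hi | ⟨p, hp, hpi, -⟩⟩ := hi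
    exacts [Or.inl hi, Or.inr (Or.inl hi), Or.inr (Or.inr ⟨p, hp, hpi⟩)]
  have hopt : ∀ o : Option (Fin n), o.toFinset.card ≤ 1 := by
    intro o
    cases o <;> simp
  calc _ ≤ _ := Finset.card_le_card hsub
    _ ≤ 1 + (1 + 1) := (Finset.card_union_le _ _).trans
      (Nat.add_le_add (Finset.card_singleton _).le
        ((Finset.card_union_le _ _).trans (Nat.add_le_add (hopt _) (hopt _))))

end Season.Describes

end Orchestra

namespace Orchestra

variable {n : ℕ} {C : Type u} [DecidableEq C] {arr : List (Packet n C) → List (Packet n C)}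

/-! ### One season of the algorithm -/

theorem coe_erase_add_singleton {α : Type*} [BEq α] [LawfulBEq α] {a : α} {l : List α}
    (h : a ∈ l) : (l.erase a : Multiset α) + {a} = l := by
  rw [add_comm, Multiset.singleton_add, Multiset.cons_coe]
  exact Multiset.coe_eq_coe.2 (List.perm_cons_erase h).symm

theorem coe_diff_add {α : Type*} [inst : BEq α] [LawfulBEq α] {s l : List α}
    (h : (s : Multiset α) ≤ l) : (l.diff s : Multiset α) + s = l := by
  classical
  obtain rfl : inst = instBEqOfDecidableEq := lawful_beq_subsingleton _ _
  rw [← Multiset.coe_sub]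
  exact Multiset.sub_add_cancel h

/-- The packets injected into station `i` in the `r` rounds from round `s` on. -/
def injected (inj : Injection n C) (s r : ℕ) (i : Fin n) : Multiset (Packet n C) :=
  ∑ j ∈ Finset.range r, (inj (s + j) i : Multiset (Packet n C))

/-- The configuration `cfg` is one in which a season can start: the stations agree on a baton list
and on the position of the baton, every schedule consists of queued packets and fits into a season,
and the musicians know when to receive. -/
structure IsSeasonStart (arr : List (Packet n C) → List (Packet n C)) (baton : List (Fin n))
    (pos : ℕ) (sched : Fin n → List (Packet n C)) (cfg : (orchestra n C arr).Config) : Prop where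
  perm : baton.Perm (List.finRange n)
  pos_lt : pos < n
  state : ∀ i, cfg.state i = startState baton pos sched i
  sched_le : ∀ i, (sched i : Multiset (Packet n C)) ≤ cfg.queue i
  length_le : ∀ i, (sched i).length ≤ n - 1

/-- The season with conductor `c` that starts in the configuration `cfg`. -/
def seasonOf (arr : List (Packet n C) → List (Packet n C)) (baton : List (Fin n))
    (pos : ℕ) (sched : Fin n → List (Packet n C)) (c : Fin n)
    (cfg : (orchestra n C arr).Config) : Season n C where
  baton := baton
  pos := pos
  sched := sched
  conductor := c
  plan := arr (((cfg.queue c).diff (sched c)).take (n - 1))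
  big := decide (n ^ 2 - 1 ≤ (cfg.queue c).length)

theorem isSeasonStart_config_zero (hn : 2 ≤ n) (inj : Injection n C) :
    IsSeasonStart arr (List.finRange n) 0 (fun _ => []) ((orchestra n C arr).config inj 0) where
  perm := List.Perm.refl _
  pos_lt := by omega
  state i := by
    change initState n C = _
    simp [initState, startState, roundsFor]
  sched_le i := Multiset.zero_le _
  length_le i := Nat.zero_le _

namespace IsSeasonStart

variable {baton : List (Fin n)} {pos : ℕ} {sched : Fin n → List (Packet n C)}
  {cfg : (orchestra n C arr).Config} {c : Fin n}

theorem exists_conductor (h : IsSeasonStart arr baton pos sched cfg) :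
    ∃ c, baton[pos]? = some c := by
  have : pos < baton.length := by
    rw [h.perm.length_eq, List.length_finRange]
    exact h.pos_lt
  exact ⟨_, List.getElem?_eq_getElem this⟩

theorem begin_season_seasonOf :
    begin_season arr c ((seasonOf arr baton pos sched c cfg).initial c) (cfg.queue c) =
      (seasonOf arr baton pos sched c cfg).informed c := by
  unfold begin_season Season.informed
  by_cases hb : n ^ 2 - 1 ≤ (cfg.queue c).length <;>
    simp [hb, seasonOf, Season.initial, startState]

/-- A packet of the schedule stays in the queue until its turn comes. -/
theorem scheduled_mem_queue (h : IsSeasonStart arr baton pos sched cfg) {r : ℕ}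
    {q : List (Packet n C)} {x : Multiset (Packet n C)}
    (hq : (q : Multiset (Packet n C)) + ((sched c).take r : Multiset (Packet n C)) =
      cfg.queue c + x)
    {p : Packet n C} (hp : (sched c)[r]? = some p) : p ∈ q := by
  have h1 : ((sched c).take r : Multiset (Packet n C)) + {p} ≤ sched c := by
    have h2 : ((sched c).take (r + 1) : Multiset (Packet n C)) ≤ sched c :=
      Multiset.coe_le.2 (List.take_sublist _ _).subperm
    rw [List.take_add_one, hp, Option.toList_some, ← Multiset.coe_add] at h2
    exact h2
  have h2 := (h1.trans (h.sched_le c)).trans (Multiset.le_add_right _ x)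
  rw [← hq, add_comm] at h2
  exact Multiset.mem_coe.1 (Multiset.singleton_le.1 (le_of_add_le_add_right h2))

/-- Round `r` of a season that starts in round `m * (n - 1)`. Each queue holds what it held at the
start of the season and what has been injected since, except that the conductor has got rid of the
first `r` packets of its schedule. -/
theorem config_season (hn : 2 ≤ n) (inj : Injection n C) (m : ℕ)
    (h : IsSeasonStart arr baton pos sched ((orchestra n C arr).config inj (m * (n - 1))))
    (hc : baton[pos]? = some c) (r : ℕ) (hr : r ≤ n - 1) :
    (∀ i, (((orchestra n C arr).config inj (m * (n - 1) + r)).queue i : Multiset (Packet n C)) +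
        (if i = c then ((sched c).take r : Multiset (Packet n C)) else 0) =
      ((orchestra n C arr).config inj (m * (n - 1))).queue i + injected inj (m * (n - 1)) r i) ∧
    (r < n - 1 →
      (seasonOf arr baton pos sched c ((orchestra n C arr).config inj (m * (n - 1)))).Describes arr
        (m * (n - 1) + r) r ((orchestra n C arr).config inj (m * (n - 1) + r))) ∧
    (r = n - 1 → ∀ i, ((orchestra n C arr).config inj (m * (n - 1) + r)).state i =
      startState
        (seasonOf arr baton pos sched c ((orchestra n C arr).config inj (m * (n - 1)))).nextBaton
        (seasonOf arr baton pos sched c ((orchestra n C arr).config inj (m * (n - 1)))).nextPos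
        (seasonOf arr baton pos sched c ((orchestra n C arr).config inj (m * (n - 1)))).nextSched
        i) := by
  set S := seasonOf arr baton pos sched c ((orchestra n C arr).config inj (m * (n - 1))) with hS
  induction r with
  | zero =>
    refine ⟨fun i => by simp [injected], fun hr => ?_, fun h0 => by omega⟩
    refine ⟨hc, phase_season m hr, fun i => ?_, fun _ => begin_season_seasonOf⟩
    rw [S.stateAt_zero]
    exact h.state i
  | succ r ih =>
    obtain ⟨hq, hd, -⟩ := ih (by omega)
    have hd := hd (by omega)
    have hstate : ∀ i, ((orchestra n C arr).config inj (m * (n - 1) + (r + 1))).state i =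
        tick i (m * (n - 1) + r) (S.stateAt (r + 1) i) := hd.step_state inj
    have hqueue : ∀ i, ((orchestra n C arr).config inj (m * (n - 1) + (r + 1))).queue i =
        (orchestra n C arr).settled (m * (n - 1) + r)
          ((orchestra n C arr).config inj (m * (n - 1) + r)) i ++ inj (m * (n - 1) + r) i :=
      fun i => rfl
    refine ⟨fun i => ?_, fun hr' => ?_, fun hr' i => ?_⟩
    · rw [hqueue, ← Multiset.coe_add]
      have hinj : injected inj (m * (n - 1)) (r + 1) i =
          injected inj (m * (n - 1)) r i + (inj (m * (n - 1) + r) i : Multiset (Packet n C)) :=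
        Finset.sum_range_succ _ _
      rw [hinj, ← add_assoc, ← hq i]
      by_cases hi : i = c
      · subst hi
        have hset := hd.settled_conductor
        change (orchestra n C arr).settled _ _ i = (match (sched i)[r]? with
          | none => ((orchestra n C arr).config inj (m * (n - 1) + r)).queue i
          | some p => (((orchestra n C arr).config inj (m * (n - 1) + r)).queue i).erase p) at hset
        rw [hset, if_pos rfl, if_pos rfl, List.take_add_one]
        rcases hp : (sched i)[r]? with _ | p
        · simp only [Option.toList_none, List.append_nil]
          exact add_right_comm _ _ _
        · have hmem := h.scheduled_mem_queue ((hq i).symm.trans (by rw [if_pos rfl])).symm hp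
          have he : (((((orchestra n C arr).config inj (m * (n - 1) + r)).queue i).erase p :
                List (Packet n C)) : Multiset (Packet n C)) + {p} =
              ((orchestra n C arr).config inj (m * (n - 1) + r)).queue i :=
            coe_erase_add_singleton hmem
          simp only [Option.toList_some]
          rw [← he, ← Multiset.coe_add, Multiset.coe_singleton]
          abel
      · rw [hd.settled_of_ne hi, if_neg hi, if_neg hi, add_zero, add_zero]
    · refine ⟨hc, phase_season m hr', fun i => ?_, fun h0 => absurd h0 r.succ_ne_zero⟩
      rw [hstate, tick, if_neg]
      rw [add_assoc, phase_season m hr']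
      exact r.succ_ne_zero
    · have hphase : phase n (m * (n - 1) + r + 1) = 0 := by
        rw [add_assoc, hr', phase, ← Nat.succ_mul, Nat.mul_mod_left]
      rw [hstate, tick, if_pos hphase, hr', S.stateAt_last hn]
      exact S.end_season_informed hc i

/-- The season after a season. -/
theorem next (harr : ∀ l, (arr l).Perm l) (hn : 2 ≤ n) (inj : Injection n C) (m : ℕ)
    (h : IsSeasonStart arr baton pos sched ((orchestra n C arr).config inj (m * (n - 1))))
    (hc : baton[pos]? = some c) {S : Season n C}
    (hS : S = seasonOf arr baton pos sched c ((orchestra n C arr).config inj (m * (n - 1)))) :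
    IsSeasonStart arr S.nextBaton S.nextPos S.nextSched
      ((orchestra n C arr).config inj ((m + 1) * (n - 1))) := by
  obtain ⟨hq, -, hstate⟩ := h.config_season hn inj m hc (n - 1) le_rfl
  rw [← Nat.succ_mul] at hq hstate
  subst hS
  have hmem : c ∈ baton := List.mem_of_getElem? hc
  refine ⟨?_, ?_, hstate rfl, fun i => ?_, fun i => ?_⟩
  · unfold Season.nextBaton
    split_ifs
    · exact (List.perm_cons_erase hmem).symm.trans h.perm
    · exact h.perm
  · unfold Season.nextPos
    split_ifs
    · omega
    · exact Nat.mod_lt _ (by omega)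
  · have hi := hq i
    by_cases hic : i = c
    · subst hic
      rw [if_pos rfl, List.take_of_length_le (h.length_le i)] at hi
      simp only [Season.nextSched, seasonOf, Function.update_self]
      rw [Multiset.coe_eq_coe.2 (harr _)]
      refine le_trans (Multiset.coe_le.2 (List.take_sublist _ _).subperm) ?_
      rw [← coe_diff_add (h.sched_le i), add_right_comm] at hi
      rw [add_right_cancel hi]
      exact Multiset.le_add_right _ _
    · rw [if_neg hic, add_zero] at hi
      simp only [Season.nextSched, seasonOf, Function.update_of_ne hic]
      rw [hi]
      exact (h.sched_le i).trans (Multiset.le_add_right _ _)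
  · by_cases hic : i = c
    · subst hic
      simp only [Season.nextSched, seasonOf, Function.update_self]
      rw [(harr _).length_eq, List.length_take]
      exact min_le_left _ _
    · simp only [Season.nextSched, seasonOf, Function.update_of_ne hic]
      exact h.length_le i

/-- The number of packets that a conductor selects for its next season. -/
theorem length_plan (harr : ∀ l, (arr l).Perm l) (h : IsSeasonStart arr baton pos sched cfg)
    (c : Fin n) : (seasonOf arr baton pos sched c cfg).plan.length =
      min (n - 1) ((cfg.queue c).length - (sched c).length) := by
  rw [seasonOf, (harr _).length_eq, List.length_take]
  have := congrArg Multiset.card (coe_diff_add (h.sched_le c))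
  rw [Multiset.card_add] at this
  simp only [Multiset.coe_card] at this
  congr 1
  omega

end IsSeasonStart

theorem exists_isSeasonStart (harr : ∀ l, (arr l).Perm l) (hn : 2 ≤ n) (inj : Injection n C)
    (m : ℕ) : ∃ baton pos sched,
      IsSeasonStart arr baton pos sched ((orchestra n C arr).config inj (m * (n - 1))) := by
  induction m with
  | zero => exact ⟨_, _, _, by simpa using isSeasonStart_config_zero hn inj⟩
  | succ m ih =>
    obtain ⟨baton, pos, sched, h⟩ := ih
    obtain ⟨c, hc⟩ := h.exists_conductor
    exact ⟨_, _, _, h.next harr hn inj m hc rfl⟩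

/-- Every round of an execution is a round of some season, the packet scheduled for this round is in
the queue of the conductor, and at most `n - 1` packets are selected for the next season. -/
theorem exists_describes (harr : ∀ l, (arr l).Perm l) (hn : 2 ≤ n) (inj : Injection n C) (t : ℕ) :
    ∃ (S : Season n C) (r : ℕ), S.Describes arr t r ((orchestra n C arr).config inj t) ∧
      (∀ p, (S.sched S.conductor)[r]? = some p →
        p ∈ ((orchestra n C arr).config inj t).queue S.conductor) ∧
      ∃ l : List (Packet n C), l.length ≤ n - 1 ∧ S.plan = arr l := by
  have ht : t / (n - 1) * (n - 1) + t % (n - 1) = t := Nat.div_add_mod' _ _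
  have hr : t % (n - 1) < n - 1 := Nat.mod_lt _ (by omega)
  obtain ⟨baton, pos, sched, h⟩ := exists_isSeasonStart harr hn inj (t / (n - 1))
  obtain ⟨c, hc⟩ := h.exists_conductor
  obtain ⟨hq, hd, -⟩ := h.config_season hn inj _ hc _ hr.le
  have hd := hd hr
  have hmem := fun p => h.scheduled_mem_queue ((hq c).symm.trans (by rw [if_pos rfl])).symm (p := p)
  rw [ht] at hd hmem
  exact ⟨_, _, hd, hmem, _, List.length_take_le _ _, rfl⟩

theorem hasEnergyCap (harr : ∀ l, (arr l).Perm l) (hn : 2 ≤ n) :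
    (orchestra n C arr).HasEnergyCap 3 := by
  intro inj t
  obtain ⟨S, r, hd, -⟩ := exists_describes harr hn inj t
  exact hd.card_isOn_le

theorem routesDirectly (harr : ∀ l, (arr l).Perm l) (hn : 2 ≤ n) :
    (orchestra n C arr).RoutesDirectly := by
  intro inj t i m p hs _ hp
  obtain ⟨S, r, hd, hmem, -⟩ := exists_describes harr hn inj t
  rw [hd.sent_eq] at hs
  split_ifs at hs with hi
  have hm := Option.some.inj hs
  subst hm
  have hp' : (S.sched S.conductor)[r]? = some p := Season.Describes.packet_eq.symm.trans hp
  subst hi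
  exact ⟨hmem p hp', hd.isOn_destination hp'⟩

end Orchestra

namespace Orchestra

variable {n : ℕ}

/-! ### Light seasons -/

theorem idxOf_move_to_front {α : Type*} [DecidableEq α] {L : List α} (hL : L.Nodup) {c x : α}
    (hc : c ∈ L) (hx : x ≠ c) : (c :: L.erase c).idxOf x =
      if L.idxOf x < L.idxOf c then L.idxOf x + 1 else L.idxOf x := by
  rw [List.idxOf_cons_ne _ hx.symm]
  induction L with
  | nil => simp at hc
  | cons a L ih =>
    rw [List.nodup_cons] at hL
    by_cases ha : a = c
    · subst ha
      simp [List.idxOf_cons_ne _ hx.symm]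
    · have hcL : c ∈ L := by simpa [Ne.symm ha] using hc
      have := ih hL.2 hcL
      rw [List.erase_cons_tail (by simpa using ha), List.idxOf_cons_ne _ ha]
      by_cases hax : a = x
      · subst hax
        simp
      · rw [List.idxOf_cons_ne _ hax, List.idxOf_cons_ne _ hax]
        simp only [Nat.succ_lt_succ_iff]
        split_ifs at this ⊢ <;> simp_all

/-- The state of the search for big stations at the start of a season, in terms of the baton list
`L`, the position `p` of the baton, the numbers `q` of packets in the queues and `s` of packets in
the schedules. The first `d` stations of the list have been found big before; `ℓ` is a bound on the
number of light seasons so far.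

A station found big has many packets and a full schedule, and its reserve shrinks by `n - 1` packets
only when the baton passes it, after which it moves one position down the list, as the search
ends with a big station that jumps over it. As some big station is always ahead of the baton, the
search never wraps around.

The bound on `ℓ` allows for `n` light seasons before the search starts, for `n` light seasons
before each station found, and for those since the last one was found, in which the baton was beyond
the first `d` positions (the subtraction is truncated: there are none if `p ≤ d`). -/
structure Search (L : List (Fin n)) (p : ℕ) (q s : Fin n → ℕ) (d ℓ : ℕ) : Prop where
  found_le : d ≤ n
  ahead : ∀ x, L.idxOf x < d → p ≤ L.idxOf x →
    (n - 1) * (n - L.idxOf x) ≤ q x ∧ s x = n - 1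
  passed : ∀ x, L.idxOf x < d → L.idxOf x < p →
    (n - 1) * (n - (L.idxOf x + 1)) ≤ q x ∧ (L.idxOf x + 1 < n → s x = n - 1)
  exists_big : ∃ z, p ≤ L.idxOf z ∧ n ^ 2 - 1 ≤ q z
  light_le : ℓ ≤ n + n * d + (p - d)

/-- How the lengths of the queues and of the schedules may change in a season with conductor `c`. -/
structure Evolves (c : Fin n) (q s q' s' : Fin n → ℕ) : Prop where
  queue_of_ne : ∀ x, x ≠ c → q x ≤ q' x
  sched_of_ne : ∀ x, x ≠ c → s' x = s x
  queue_conductor : q c ≤ q' c + s c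
  sched_le : s c ≤ n - 1
  sched_conductor : s' c = min (n - 1) (q c - s c)

theorem sub_one_mul_sub {p : ℕ} (hp : p < n) :
    (n - 1) * (n - p) = (n - 1) * (n - (p + 1)) + (n - 1) := by
  obtain ⟨k, rfl⟩ := Nat.exists_eq_add_of_lt hp
  have h1 : p + k + 1 - p = k + 1 := by omega
  have h2 : p + k + 1 - (p + 1) = k := by omega
  rw [h1, h2, Nat.mul_succ]

theorem sq_sub_one (hn : 2 ≤ n) : n ^ 2 - 1 = (n - 1) * n + (n - 1) := by
  obtain ⟨k, rfl⟩ := Nat.exists_eq_add_of_le' hn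
  have h : k + 2 - 1 = k + 1 := by omega
  rw [h]
  apply Nat.sub_eq_of_eq_add
  ring

variable {L : List (Fin n)} {c : Fin n} {q s q' s' : Fin n → ℕ} {d ℓ : ℕ}

/-- A big conductor keeps enough packets and gets a full schedule. -/
theorem Evolves.of_big (hn : 2 ≤ n) (hev : Evolves c q s q' s') (hbig : n ^ 2 - 1 ≤ q c) :
    (n - 1) * n ≤ q' c ∧ s' c = n - 1 := by
  have h1 := hev.queue_conductor
  have h2 := hev.sched_le
  have h3 := hev.sched_conductor
  have h4 := sq_sub_one hn
  have h5 : n - 1 ≤ (n - 1) * n := Nat.le_mul_of_pos_right _ (by omega)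
  constructor <;> omega

namespace Search

theorem pass (hL : L.Perm (List.finRange n))
    (h : Search L (L.idxOf c) q s d ℓ) (hev : Evolves c q s q' s') (hbig : ¬ n ^ 2 - 1 ≤ q c) :
    L.idxOf c + 1 < n ∧
      Search L (L.idxOf c + 1) q' s' d (ℓ + if s c = n - 1 then 0 else 1) := by
  have hmem : ∀ x, x ∈ L := fun x => hL.mem_iff.2 (List.mem_finRange x)
  have hlt : ∀ x, L.idxOf x < n := fun x => by
    have := List.idxOf_lt_length_of_mem (hmem x)
    rwa [hL.length_eq, List.length_finRange] at this
  have hinj : ∀ x, x ≠ c → L.idxOf x ≠ L.idxOf c := fun x hx he =>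
    hx ((List.idxOf_inj (hmem x)).1 he)
  obtain ⟨z, hz, hzq⟩ := h.exists_big
  have hzc : z ≠ c := by
    rintro rfl
    exact hbig hzq
  have hz' : L.idxOf c + 1 ≤ L.idxOf z := by
    have := hinj z hzc
    omega
  refine ⟨hz'.trans_lt (hlt z), h.found_le, fun x hx hp => ?_, fun x hx hp => ?_,
    ⟨z, hz', hzq.trans (hev.queue_of_ne z hzc)⟩, ?_⟩
  · have hxc : x ≠ c := by
      rintro rfl
      omega
    have := h.ahead x hx (by omega)
    exact ⟨this.1.trans (hev.queue_of_ne x hxc), (hev.sched_of_ne x hxc).trans this.2⟩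
  · by_cases hxc : x = c
    · subst hxc
      -- The conductor has been found before and is passed now: it pays `n - 1` packets of its reserve.
      obtain ⟨h1, h2⟩ := h.ahead x hx le_rfl
      have h3 := hev.queue_conductor
      have h4 := hev.sched_conductor
      rw [sub_one_mul_sub (hlt x)] at h1
      refine ⟨by omega, fun h5 => ?_⟩
      have h6 : n - 1 ≤ (n - 1) * (n - (L.idxOf x + 1)) :=
        Nat.le_mul_of_pos_right _ (by omega)
      omega
    · have := h.passed x hx (by have := hinj x hxc; omega)
      rw [hev.sched_of_ne x hxc]
      exact ⟨this.1.trans (hev.queue_of_ne x hxc), this.2⟩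
  · have h1 := h.light_le
    by_cases hd : L.idxOf c < d
    · rw [if_pos (h.ahead c hd le_rfl).2]
      omega
    · split_ifs <;> omega

theorem find (hn : 2 ≤ n) (hL : L.Perm (List.finRange n))
    (h : Search L (L.idxOf c) q s d ℓ) (hev : Evolves c q s q' s') (hbig : n ^ 2 - 1 ≤ q c)
    (hnext : ∃ z, n ^ 2 - 1 ≤ q' z) :
    Search (c :: L.erase c) 0 q' s' (if L.idxOf c < d then d else d + 1)
      (ℓ + if s c = n - 1 then 0 else 1) := by
  have hmem : ∀ x, x ∈ L := fun x => hL.mem_iff.2 (List.mem_finRange x)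
  have hlt : ∀ x, L.idxOf x < n := fun x => by
    have := List.idxOf_lt_length_of_mem (hmem x)
    rwa [hL.length_eq, List.length_finRange] at this
  have hc := hlt c
  have hinj : ∀ x, x ≠ c → L.idxOf x ≠ L.idxOf c := fun x hx he =>
    hx ((List.idxOf_inj (hmem x)).1 he)
  have hnd : L.Nodup := hL.nodup_iff.2 (List.nodup_finRange n)
  obtain ⟨z, hz⟩ := hnext
  refine ⟨?_, fun x hx _ => ?_, fun x _ h0 => absurd h0 (Nat.not_lt_zero _),
    ⟨z, Nat.zero_le _, hz⟩, ?_⟩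
  · have := h.found_le
    split_ifs <;> omega
  · by_cases hxc : x = c
    · subst hxc
      rw [List.idxOf_cons_self, Nat.sub_zero]
      exact hev.of_big hn hbig
    · rw [idxOf_move_to_front hnd (hmem c) hxc] at hx ⊢
      rw [hev.sched_of_ne x hxc]
      have hq := hev.queue_of_ne x hxc
      have hne := hinj x hxc
      by_cases hxp : L.idxOf x < L.idxOf c
      · -- The conductor jumps over `x`, whose bounds for the next position hold already.
        rw [if_pos hxp] at hx ⊢
        have hxd : L.idxOf x < d := by split_ifs at hx <;> omega
        obtain ⟨h1, h2⟩ := h.passed x hxd hxp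
        exact ⟨h1.trans hq, h2 (by omega)⟩
      · rw [if_neg hxp] at hx ⊢
        have hxd : L.idxOf x < d := by split_ifs at hx <;> omega
        obtain ⟨h1, h2⟩ := h.ahead x hxd (by omega)
        exact ⟨h1.trans hq, h2⟩
  · have h1 := h.light_le
    by_cases hd : L.idxOf c < d
    · rw [if_pos (h.ahead c hd le_rfl).2, if_pos hd]
      omega
    · rw [if_neg hd, Nat.mul_succ]
      split_ifs <;> omega

/-- A bound on the number of light seasons, whatever has been found. -/
theorem light_le_of_pos_lt {p : ℕ} (h : Search L p q s d ℓ) (hp : p < n) : ℓ ≤ n + n * n := by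
  have h1 := h.light_le
  have h2 := h.found_le
  rcases h2.lt_or_eq with h3 | rfl
  · have h4 := Nat.mul_le_mul_left n (Nat.succ_le_of_lt h3)
    rw [Nat.mul_succ] at h4
    omega
  · omega

end Search

/-- The search that starts at the front of the list, nothing having been found before. -/
theorem search_zero (hz : ∃ z, n ^ 2 - 1 ≤ q z) (hℓ : ℓ ≤ n) : Search L 0 q s 0 ℓ := by
  obtain ⟨z, hz⟩ := hz
  exact ⟨Nat.zero_le _, fun x hx => absurd hx (Nat.not_lt_zero _),
    fun x hx => absurd hx (Nat.not_lt_zero _), ⟨z, Nat.zero_le _, hz⟩, by omega⟩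

/-- The search after a first big conductor. -/
theorem search_of_big (hn : 2 ≤ n) (hev : Evolves c q s q' s') (hbig : n ^ 2 - 1 ≤ q c)
    (hz : ∃ z, n ^ 2 - 1 ≤ q' z) (hℓ : ℓ ≤ n) : Search (c :: L.erase c) 0 q' s' 1 ℓ := by
  obtain ⟨z, hz⟩ := hz
  refine ⟨by omega, fun x hx _ => ?_, fun x _ h0 => absurd h0 (Nat.not_lt_zero _),
    ⟨z, Nat.zero_le _, hz⟩, by omega⟩
  have hxc : x = c := by
    by_contra hxc
    rw [List.idxOf_cons_ne _ (Ne.symm hxc)] at hx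
    omega
  subst hxc
  rw [List.idxOf_cons_self, Nat.sub_zero]
  exact hev.of_big hn hbig

theorem exists_big_of_lt_sum (h : n ^ 3 - 2 * n < ∑ x, q x) :
    ∃ z, n ^ 2 - 1 ≤ q z := by
  by_contra! hall
  have h1 : ∑ x, q x ≤ n * (n ^ 2 - 2) := by
    calc ∑ x, q x ≤ ∑ _x : Fin n, (n ^ 2 - 2) :=
          Finset.sum_le_sum fun x _ => by have := hall x; omega
      _ = n * (n ^ 2 - 2) := by simp
  have h2 : n * (n ^ 2 - 2) = n ^ 3 - 2 * n := by
    rw [Nat.mul_sub]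
    congr 1 <;> ring
  omega

end Orchestra

namespace Orchestra

variable {n : ℕ} {C : Type u} [DecidableEq C] {arr : List (Packet n C) → List (Packet n C)}

/-! ### The bound on the number of queued packets -/

/-- The number of packets injected before round `t`. -/
def injectedBefore (inj : Injection n C) (t : ℕ) : ℕ := ∑ r ∈ Finset.range t, inj.count r

omit [DecidableEq C] in
theorem injectedBefore_add (inj : Injection n C) (s r : ℕ) :
    injectedBefore inj (s + r) = injectedBefore inj s + ∑ j ∈ Finset.range r, inj.count (s + j) :=
  Finset.sum_range_add _ _ _

omit [DecidableEq C] in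
theorem sum_card_injected (inj : Injection n C) (s r : ℕ) :
    ∑ i, (injected inj s r i).card = ∑ j ∈ Finset.range r, inj.count (s + j) := by
  simp only [injected, Multiset.card_sum, Multiset.coe_card, Injection.count]
  exact Finset.sum_comm

/-- The number of packets in the queues at the start of round `t`. -/
def total (arr : List (Packet n C) → List (Packet n C)) (inj : Injection n C) (t : ℕ) : ℕ :=
  ∑ i, (((orchestra n C arr).config inj t).queue i).length

namespace IsSeasonStart

variable {baton : List (Fin n)} {pos : ℕ} {sched : Fin n → List (Packet n C)} {c : Fin n}

theorem idxOf_eq {cfg : (orchestra n C arr).Config} (h : IsSeasonStart arr baton pos sched cfg)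
    (hc : baton[pos]? = some c) : baton.idxOf c = pos := by
  have hnd : baton.Nodup := h.perm.nodup_iff.2 (List.nodup_finRange n)
  have h1 := List.getElem?_idxOf (List.mem_of_getElem? hc)
  have h2 := (List.getElem?_eq_some_iff.1 hc).1
  exact ((List.getElem?_inj h2 hnd).1 (hc.trans h1.symm)).symm

variable (hn : 2 ≤ n) {inj : Injection n C} {m : ℕ}
  (h : IsSeasonStart arr baton pos sched ((orchestra n C arr).config inj (m * (n - 1))))
  (hc : baton[pos]? = some c)
include hn h hc

theorem total_add {r : ℕ} (hr : r ≤ n - 1) :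
    total arr inj (m * (n - 1) + r) + ((sched c).take r).length + injectedBefore inj (m * (n - 1)) =
      total arr inj (m * (n - 1)) + injectedBefore inj (m * (n - 1) + r) := by
  have hq := (h.config_season hn inj m hc r hr).1
  have hsum := Finset.sum_congr (rfl : (Finset.univ : Finset (Fin n)) = Finset.univ)
    fun i _ => congrArg Multiset.card (hq i)
  simp only [Multiset.card_add, Finset.sum_add_distrib, sum_card_injected, Multiset.coe_card,
    apply_ite Multiset.card, Multiset.card_zero, Finset.sum_ite_eq', Finset.mem_univ,
    if_true] at hsum
  rw [injectedBefore_add]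
  unfold total
  omega

theorem evolves (harr : ∀ l, (arr l).Perm l) :
    Evolves c
      (fun x => (((orchestra n C arr).config inj (m * (n - 1))).queue x).length)
      (fun x => (sched x).length)
      (fun x => (((orchestra n C arr).config inj ((m + 1) * (n - 1))).queue x).length)
      (fun x => ((seasonOf arr baton pos sched c
        ((orchestra n C arr).config inj (m * (n - 1)))).nextSched x).length) := by
  have hq := (h.config_season hn inj m hc (n - 1) le_rfl).1
  rw [← Nat.succ_mul] at hq
  have hcard := fun i => congrArg Multiset.card (hq i)
  simp only [Multiset.card_add, Multiset.coe_card, apply_ite Multiset.card,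
    Multiset.card_zero] at hcard
  refine ⟨fun x hx => ?_, fun x hx => ?_, ?_, h.length_le c, ?_⟩
  · have := hcard x
    rw [if_neg hx] at this
    exact (Nat.le_add_right _ _).trans this.symm.le
  · simp only [Season.nextSched, seasonOf, Function.update_of_ne hx]
  · have := hcard c
    rw [if_pos rfl, List.take_of_length_le (h.length_le c)] at this
    exact (Nat.le_add_right _ _).trans this.symm.le
  · have := h.length_plan harr c
    simp only [Season.nextSched]
    rw [← this]
    exact congrArg List.length (Function.update_self (f := sched) c _)

end IsSeasonStart

/-- The invariant of the seasons. Since the start of season `m₁`, when the number of queued packets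
was at most `n ^ 3 - 2 * n`, at most `ℓ` seasons have been light; either no big conductor has been
found since, and the baton has not reached the end of the list, or the search for big stations is
under way. -/
structure Invariant (arr : List (Packet n C) → List (Packet n C)) (inj : Injection n C) (m : ℕ)
    (baton : List (Fin n)) (pos : ℕ) (sched : Fin n → List (Packet n C)) (m₁ ℓ : ℕ) : Prop where
  start : IsSeasonStart arr baton pos sched ((orchestra n C arr).config inj (m * (n - 1)))
  le : m₁ ≤ m
  total_le : total arr inj (m * (n - 1)) + m * (n - 1) + injectedBefore inj (m₁ * (n - 1)) ≤
    (n ^ 3 - 2 * n) + m₁ * (n - 1) + injectedBefore inj (m * (n - 1)) + (n - 1) * ℓ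
  search : ℓ ≤ pos ∨ ∃ d, Search baton pos
    (fun x => (((orchestra n C arr).config inj (m * (n - 1))).queue x).length)
    (fun x => (sched x).length) d ℓ

theorem exists_invariant (harr : ∀ l, (arr l).Perm l) (hn : 2 ≤ n) (inj : Injection n C) (m : ℕ) :
    ∃ baton pos sched m₁ ℓ, Invariant arr inj m baton pos sched m₁ ℓ := by
  induction m with
  | zero =>
    refine ⟨_, _, _, 0, 0, by simpa using isSeasonStart_config_zero hn inj, le_rfl, ?_,
      Or.inl le_rfl⟩
    simp [total, RoutingAlgorithm.config]
  | succ m ih =>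
    obtain ⟨baton, pos, sched, m₁, ℓ, h, hle, htot, hsearch⟩ := ih
    obtain ⟨c, hc⟩ := h.exists_conductor
    have hnext := h.next harr hn inj m hc rfl
    set S := seasonOf arr baton pos sched c ((orchestra n C arr).config inj (m * (n - 1))) with hS
    -- With few packets in the queues, the count of light seasons starts afresh.
    by_cases hsmall : total arr inj ((m + 1) * (n - 1)) ≤ n ^ 3 - 2 * n
    · exact ⟨_, _, _, m + 1, 0, hnext, le_rfl, by omega, Or.inl (Nat.zero_le _)⟩
    have hz := exists_big_of_lt_sum (not_le.1 hsmall)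
    have hev := h.evolves hn hc harr
    rw [← hS] at hev
    refine ⟨_, _, _, m₁, ℓ + if (sched c).length = n - 1 then 0 else 1, hnext, by omega, ?_, ?_⟩
    · have hadd := h.total_add hn hc le_rfl
      rw [← Nat.succ_mul, List.take_of_length_le (h.length_le c)] at hadd
      rw [Nat.succ_mul, Nat.mul_add]
      rw [Nat.succ_mul] at hadd
      split_ifs with hfull
      · omega
      · omega
    · have hpos := h.idxOf_eq hc
      have hpos_lt := h.pos_lt
      have hlight : (if (sched c).length = n - 1 then 0 else 1) ≤ 1 := by split_ifs <;> simp
      by_cases hbig : n ^ 2 - 1 ≤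
          (((orchestra n C arr).config inj (m * (n - 1))).queue c).length
      · have hb : S.nextBaton = c :: baton.erase c ∧ S.nextPos = 0 := by
          simp [Season.nextBaton, Season.nextPos, hS, seasonOf, hbig]
        rw [hb.1, hb.2]
        right
        rcases hsearch with hℓ | ⟨d, hd⟩
        · exact ⟨_, search_of_big hn hev hbig hz (by omega)⟩
        · rw [← hpos] at hd
          exact ⟨_, hd.find hn h.perm hev hbig hz⟩
      · have hb : S.nextBaton = baton ∧ S.nextPos = (pos + 1) % n := by
          simp [Season.nextBaton, Season.nextPos, hS, seasonOf, hbig]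
        rw [hb.1, hb.2]
        rcases hsearch with hℓ | ⟨d, hd⟩
        · -- Only before the first discovery may the baton return to the head of the list.
          rcases (Nat.succ_le_of_lt hpos_lt).lt_or_eq with hp | hp
          · left
            rw [Nat.mod_eq_of_lt hp]
            omega
          · right
            rw [← Nat.succ_eq_add_one, hp, Nat.mod_self]
            exact ⟨0, search_zero hz (by omega)⟩
        · right
          rw [← hpos] at hd
          obtain ⟨h1, h2⟩ := hd.pass h.perm hev hbig
          rw [← hpos, Nat.mod_eq_of_lt h1]
          exact ⟨d, h2⟩

theorem queueSize_le (harr : ∀ l, (arr l).Perm l) (hn : 2 ≤ n) {β : ℝ} {inj : Injection n C}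
    (hinj : inj.IsOfType 1 β) (t : ℕ) :
    ((orchestra n C arr).queueSize inj t : ℝ) ≤ 2 * (n : ℝ) ^ 3 + β := by
  obtain ⟨m, r, hr, rfl⟩ : ∃ m r, r < n - 1 ∧ m * (n - 1) + r = t :=
    ⟨t / (n - 1), t % (n - 1), Nat.mod_lt _ (by omega), Nat.div_add_mod' _ _⟩
  obtain ⟨baton, pos, sched, m₁, ℓ, h, hle, htot, hsearch⟩ := exists_invariant harr hn inj m
  obtain ⟨c, hc⟩ := h.exists_conductor
  have hℓ : ℓ ≤ n + n * n := by
    rcases hsearch with h1 | ⟨d, hd⟩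
    · exact h1.trans (h.pos_lt.le.trans (Nat.le_add_right _ _))
    · exact hd.light_le_of_pos_lt h.pos_lt
  have hadd := h.total_add hn hc hr.le
  have hsize : (orchestra n C arr).queueSize inj (m * (n - 1) + r) + injectedBefore inj
      (m * (n - 1) + r) = total arr inj (m * (n - 1) + r) +
        injectedBefore inj (m * (n - 1) + r + 1) := by
    have := injectedBefore_add inj (m * (n - 1) + r) 1
    simp only [Finset.sum_range_one, add_zero] at this
    rw [this, RoutingAlgorithm.queueSize, total]
    omega
  have hm : m₁ * (n - 1) ≤ m * (n - 1) := Nat.mul_le_mul_right _ hle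
  obtain ⟨k, hk⟩ := Nat.exists_eq_add_of_le hm
  have hwin := hinj (m₁ * (n - 1)) (k + r + 1)
  have hwin' := injectedBefore_add inj (m₁ * (n - 1)) (k + r + 1)
  rw [show m₁ * (n - 1) + (k + r + 1) = m * (n - 1) + r + 1 by omega] at hwin'
  -- The burstiness is charged once, for the window from the start of season `m₁` to this round.
  set w := ∑ j ∈ Finset.range (k + r + 1), inj.count (m₁ * (n - 1) + j) with hw
  have hprod : (n - 1) * ℓ + (r + 1) ≤ (n - 1) * (n + n * n + 1) := by
    rw [Nat.mul_succ]
    exact Nat.add_le_add (Nat.mul_le_mul_left _ hℓ) hr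
  have hnat : (orchestra n C arr).queueSize inj (m * (n - 1) + r) + (k + r + 1) ≤
      (n ^ 3 - 2 * n) + (n - 1) * (n + n * n + 1) + w := by
    omega
  have hcube : (n ^ 3 - 2 * n) + (n - 1) * (n + n * n + 1) ≤ 2 * n ^ 3 := by
    have : (n - 1) * (n + n * n + 1) + 1 = n ^ 3 := by
      obtain ⟨j, rfl⟩ := Nat.exists_eq_add_of_le' hn
      rw [show j + 2 - 1 = j + 1 by omega]
      ring
    omega
  have hreal : ((orchestra n C arr).queueSize inj (m * (n - 1) + r) : ℝ) + ((k + r + 1 : ℕ) : ℝ) ≤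
      2 * (n : ℝ) ^ 3 + w := by
    exact_mod_cast hnat.trans (Nat.add_le_add_right hcube w)
  linarith

theorem isStableAt_one (harr : ∀ l, (arr l).Perm l) (hn : 2 ≤ n) :
    (orchestra n C arr).IsStableAt 1 := by
  intro β _
  refine ⟨⌈2 * (n : ℝ) ^ 3 + β⌉₊, fun inj hinj t => ?_⟩
  exact_mod_cast (queueSize_le harr hn hinj t).trans (Nat.le_ceil _)

/-! ### Instability above rate one -/

/-- At most one packet is delivered per round. -/
theorem injectedBefore_le (harr : ∀ l, (arr l).Perm l) (hn : 2 ≤ n) (inj : Injection n C) (t : ℕ) :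
    injectedBefore inj t ≤ total arr inj t + t := by
  obtain ⟨m, r, hr, rfl⟩ : ∃ m r, r < n - 1 ∧ m * (n - 1) + r = t :=
    ⟨t / (n - 1), t % (n - 1), Nat.mod_lt _ (by omega), Nat.div_add_mod' _ _⟩
  have hseason : ∀ m, injectedBefore inj (m * (n - 1)) ≤
      total arr inj (m * (n - 1)) + m * (n - 1) := by
    intro m
    induction m with
    | zero => simp [injectedBefore]
    | succ m ih =>
      obtain ⟨baton, pos, sched, h⟩ := exists_isSeasonStart harr hn inj m
      obtain ⟨c, hc⟩ := h.exists_conductor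
      have hadd := h.total_add hn hc le_rfl
      have := List.length_take_le (n - 1) (sched c)
      rw [Nat.succ_mul]
      omega
  obtain ⟨baton, pos, sched, h⟩ := exists_isSeasonStart harr hn inj m
  obtain ⟨c, hc⟩ := h.exists_conductor
  have hadd := h.total_add hn hc hr.le
  have := List.length_take_le r (sched c)
  have := hseason m
  omega

/-- Injections of rate `ρ` into one station, as regular as possible: `⌊ρ * t⌋`
packets before round `t`. -/
noncomputable def steadyInjection (ρ : ℝ) (p : Packet n C) : Injection n C := fun t i =>
  if i = p.1 then List.replicate (⌊ρ * (t + 1)⌋₊ - ⌊ρ * t⌋₊) p else []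

omit [DecidableEq C] in
theorem count_steadyInjection (ρ : ℝ) (p : Packet n C) (t : ℕ) :
    (steadyInjection ρ p).count t = ⌊ρ * (t + 1)⌋₊ - ⌊ρ * t⌋₊ := by
  simp [Injection.count, steadyInjection, apply_ite List.length]

omit [DecidableEq C] in
theorem sum_count_steadyInjection {ρ : ℝ} (hρ : 0 ≤ ρ) (p : Packet n C) (s t : ℕ) :
    ⌊ρ * s⌋₊ + ∑ r ∈ Finset.range t, (steadyInjection ρ p).count (s + r) = ⌊ρ * (s + t : ℕ)⌋₊ := by
  induction t with
  | zero => simp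
  | succ t ih =>
    rw [Finset.sum_range_succ, ← add_assoc, ih, count_steadyInjection]
    have hmono : ⌊ρ * (s + t : ℕ)⌋₊ ≤ ⌊ρ * ((s + t : ℕ) + 1)⌋₊ :=
      Nat.floor_mono (mul_le_mul_of_nonneg_left (by linarith) hρ)
    rw [Nat.add_sub_cancel' hmono]
    push_cast
    rw [add_assoc]

omit [DecidableEq C] in
theorem isOfType_steadyInjection {ρ : ℝ} (hρ : 0 ≤ ρ) (p : Packet n C) :
    (steadyInjection ρ p).IsOfType ρ 1 := by
  intro s t
  have h := sum_count_steadyInjection hρ p s t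
  have h1 : (⌊ρ * (s + t : ℕ)⌋₊ : ℝ) ≤ ρ * (s + t : ℕ) :=
    Nat.floor_le (mul_nonneg hρ (Nat.cast_nonneg _))
  have h2 := Nat.lt_floor_add_one (ρ * (s : ℝ))
  rw [← h] at h1
  push_cast at h1 ⊢
  linarith

theorem le_one_of_isStableAt (harr : ∀ l, (arr l).Perm l) (hn : 2 ≤ n) [Nonempty C] {ρ : ℝ}
    (h : (orchestra n C arr).IsStableAt ρ) : ρ ≤ 1 := by
  by_contra! hρ
  obtain ⟨c⟩ := ‹Nonempty C›
  have hρ0 : 0 ≤ ρ := by linarith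
  obtain ⟨B, hB⟩ := h 1 le_rfl
  set inj : Injection n C := steadyInjection ρ (⟨0, by omega⟩, c) with hinj
  obtain ⟨t, ht⟩ := exists_nat_gt (((B : ℝ) + 1) / (ρ - 1))
  rw [div_lt_iff₀ (by linarith)] at ht
  have h1 : total arr inj t ≤ B :=
    (Nat.le_add_right _ _).trans (hB inj (isOfType_steadyInjection hρ0 _) t)
  have h2 : injectedBefore inj t = ⌊ρ * t⌋₊ := by
    have := sum_count_steadyInjection hρ0 (⟨0, by omega⟩, c) 0 t (n := n)
    simpa [injectedBefore, hinj] using this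
  have h3 := injectedBefore_le harr hn inj t
  have h4 := Nat.lt_floor_add_one (ρ * (t : ℝ))
  have h5 : ((⌊ρ * t⌋₊ : ℕ) : ℝ) ≤ B + t := by
    rw [← h2]
    exact_mod_cast h3.trans (Nat.add_le_add_right h1 t)
  nlinarith

theorem isGreatest_one (harr : ∀ l, (arr l).Perm l) (hn : 2 ≤ n) [Nonempty C] :
    IsGreatest {ρ : ℝ | 0 < ρ ∧ (orchestra n C arr).IsStableAt ρ} 1 :=
  ⟨⟨one_pos, isStableAt_one harr hn⟩, fun _ hρ => le_one_of_isStableAt harr hn hρ.2⟩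

end Orchestra

namespace Orchestra

variable {n : ℕ} {C : Type u}

/-! ### Control bits -/

/-- The rounds in which a sorted list sends packets to a given station form an interval. -/
theorem mem_roundsFor_of_lt_of_lt {l : List (Packet n C)} (hl : l.Pairwise (fun p q => p.1 ≤ q.1))
    {j : Fin n} {r s t : ℕ} (hr : r ∈ roundsFor l j) (ht : t ∈ roundsFor l j) (hrs : r ≤ s)
    (hst : s ≤ t) : s ∈ roundsFor l j := by
  rcases hrs.eq_or_lt with rfl | hrs
  · exact hr
  rcases hst.eq_or_lt with rfl | hst
  · exact ht
  obtain ⟨p, hp, rfl⟩ := mem_roundsFor.1 hr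
  obtain ⟨q, hq, hqp⟩ := mem_roundsFor.1 ht
  obtain ⟨hr', rfl⟩ := List.getElem?_eq_some_iff.1 hp
  obtain ⟨ht', rfl⟩ := List.getElem?_eq_some_iff.1 hq
  have hs' : s < l.length := hst.trans ht'
  refine mem_roundsFor.2 ⟨l[s], List.getElem?_eq_getElem hs', le_antisymm ?_ ?_⟩
  · rw [← hqp]
    exact List.pairwise_iff_getElem.1 hl s t hs' ht' hst
  · exact List.pairwise_iff_getElem.1 hl r s hr' hs' hrs

theorem pairwise_byDestination (l : List (Packet n C)) :
    (byDestination l).Pairwise (fun p q => p.1 ≤ q.1) := by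
  have h := List.pairwise_mergeSort (le := fun p q : Packet n C => decide (p.1 ≤ q.1))
    (fun a b c hab hbc => by
      simp only [decide_eq_true_eq] at hab hbc ⊢
      exact hab.trans hbc)
    (fun a b => by simpa using le_total a.1 b.1) l
  simpa [byDestination] using h

/-- A finite set without gaps is determined by its least element and its cardinality. -/
theorem eq_Ico_of_no_gaps {R : Finset ℕ} (hR : ∀ r ∈ R, ∀ t ∈ R, ∀ s, r ≤ s → s ≤ t → s ∈ R)
    (hne : R.Nonempty) :
    R = Finset.Ico (sInf (R : Set ℕ)) (sInf (R : Set ℕ) + R.card) := by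
  have hmin : sInf (R : Set ℕ) ∈ R := Nat.sInf_mem (s := (R : Set ℕ)) hne
  have hle : ∀ r ∈ R, sInf (R : Set ℕ) ≤ r := fun r hr => Nat.sInf_le (Finset.mem_coe.2 hr)
  have hIco : R = Finset.Ico (sInf (R : Set ℕ)) (R.max' hne + 1) := by
    ext s
    rw [Finset.mem_Ico, Nat.lt_succ_iff]
    exact ⟨fun h => ⟨hle s h, R.le_max' s h⟩,
      fun h => hR _ hmin _ (R.max'_mem hne) s h.1 h.2⟩
  have hcard := congrArg Finset.card hIco
  rw [Nat.card_Ico] at hcard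
  have h1 := hle _ (R.max'_mem hne)
  rw [hcard, Nat.add_sub_cancel' (by omega)]
  exact hIco

/-- The `k` lowest binary digits of `a`. -/
def bits (k a : ℕ) : List Bool := List.ofFn fun i : Fin k => a.testBit i

theorem length_bits (k a : ℕ) : (bits k a).length = k := List.length_ofFn

theorem bits_injOn {k a b : ℕ} (ha : a < 2 ^ k) (hb : b < 2 ^ k) (h : bits k a = bits k b) :
    a = b := by
  have h' := List.ofFn_injective h
  refine Nat.eq_of_testBit_eq fun i => ?_
  by_cases hi : i < k
  · exact congrFun h' ⟨i, hi⟩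
  · have hpow : 2 ^ k ≤ 2 ^ i := Nat.pow_le_pow_right two_pos (not_lt.1 hi)
    rw [Nat.testBit_lt_two_pow (ha.trans_le hpow), Nat.testBit_lt_two_pow (hb.trans_le hpow)]

/-- The encoding of control information: the toggle bit, the first round taught (`0` if there
is none) and the number of rounds taught. -/
noncomputable def encode (k : ℕ) (c : Control) : List Bool :=
  c.big :: (bits k (sInf (c.rounds : Set ℕ)) ++ bits k c.rounds.card)

variable [DecidableEq C]

/-- The rounds taught in a message are an interval of rounds of a season. -/
theorem rounds_of_mem_usedControls (hn : 2 ≤ n) {c : Control}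
    (hc : c ∈ (orchestra n C byDestination).usedControls) :
    c.rounds ⊆ Finset.range (n - 1) ∧
      ∀ r ∈ c.rounds, ∀ t ∈ c.rounds, ∀ s, r ≤ s → s ≤ t → s ∈ c.rounds := by
  obtain ⟨inj, t, i, m, hm, rfl⟩ := hc
  have hperm : ∀ l : List (Packet n C), (byDestination l).Perm l :=
    fun l => List.mergeSort_perm l _
  obtain ⟨S, r, hd, -, l, hl, hplan⟩ := exists_describes hperm hn inj t
  rw [hd.sent_eq] at hm
  split_ifs at hm with hi
  have hm := Option.some.inj hm
  subst hm
  simp only [message, S.informed_plan, hplan]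
  rcases learner S.conductor r with _ | j
  · simp
  · refine ⟨fun x hx => ?_, fun r hr t ht s hrs hst =>
      mem_roundsFor_of_lt_of_lt (pairwise_byDestination l) hr ht hrs hst⟩
    have h1 := (Finset.mem_filter.1 hx).1
    rw [(hperm l).length_eq, Finset.mem_range] at h1
    exact Finset.mem_range.2 (h1.trans_le hl)

theorem usesControlBits (hn : 2 ≤ n) :
    (orchestra n C byDestination).UsesControlBits (2 * Nat.clog 2 n + 1) := by
  refine ⟨encode (Nat.clog 2 n), fun c hc c' hc' h => ?_, fun c _ => ?_⟩
  · have hpow : n ≤ 2 ^ Nat.clog 2 n := Nat.le_pow_clog one_lt_two n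
    have hbound : ∀ R : Finset ℕ, R ⊆ Finset.range (n - 1) →
        sInf (R : Set ℕ) < 2 ^ Nat.clog 2 n ∧ R.card < 2 ^ Nat.clog 2 n := by
      intro R hR
      have hcard := Finset.card_le_card hR
      rw [Finset.card_range] at hcard
      refine ⟨?_, by omega⟩
      rcases R.eq_empty_or_nonempty with rfl | hne
      · simp
      · have := Finset.mem_range.1 (hR (Nat.sInf_mem (s := (R : Set ℕ)) hne))
        omega
    obtain ⟨h1, h2⟩ := rounds_of_mem_usedControls hn hc
    obtain ⟨h1', h2'⟩ := rounds_of_mem_usedControls hn hc'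
    obtain ⟨hbig, hbits⟩ := List.cons.inj h
    obtain ⟨hb1, hb2⟩ := List.append_inj hbits (by rw [length_bits, length_bits])
    have hmin := bits_injOn (hbound _ h1).1 (hbound _ h1').1 hb1
    have hcard := bits_injOn (hbound _ h1).2 (hbound _ h1').2 hb2
    have hrounds : c.rounds = c'.rounds := by
      rcases c.rounds.eq_empty_or_nonempty with he | hne
      · rw [he, Finset.card_empty] at hcard
        rw [he, Finset.card_eq_zero.1 hcard.symm]
      · have hne' : c'.rounds.Nonempty := by
          rw [← Finset.card_pos, ← hcard]
          exact hne.card_pos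
        rw [eq_Ico_of_no_gaps h2 hne, eq_Ico_of_no_gaps h2' hne', hmin, hcard]
    have hext : ∀ d d' : Control, d.big = d'.big → d.rounds = d'.rounds → d = d' := by
      rintro ⟨⟩ ⟨⟩ ⟨⟩ ⟨⟩
      rfl
    exact hext c c' hbig hrounds
  · simp only [encode, List.length_cons, List.length_append, length_bits]
    omega

end Orchestra

theorem mainTheorem1 {C : Type u} [DecidableEq C] [Nonempty C] (n : ℕ) (hn : 2 ≤ n)
    (arr : List (Packet n C) → List (Packet n C)) (harr : ∀ l, (arr l).Perm l) :
    (orchestra n C arr).HasEnergyCap 3 ∧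
    (orchestra n C arr).RoutesDirectly ∧
    (∀ β : ℝ, 1 ≤ β → ∀ inj : Injection n C, inj.IsOfType 1 β →
      ∀ t : ℕ, ((orchestra n C arr).queueSize inj t : ℝ) ≤ 2 * (n : ℝ) ^ 3 + β) ∧
    IsGreatest {ρ : ℝ | 0 < ρ ∧ (orchestra n C arr).IsStableAt ρ} 1 ∧
    (orchestra n C Orchestra.byDestination).UsesControlBits (2 * Nat.clog 2 n + 1) := by
  exact ⟨Orchestra.hasEnergyCap harr hn, Orchestra.routesDirectly harr hn,
    fun _ _ _ hinj t => Orchestra.queueSize_le harr hn hinj t, Orchestra.isGreatest_one harr hn,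
    Orchestra.usesControlBits hn⟩
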